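/- Let \(\mathbb{C}_0=\{s\in\mathbb{C}:\operatorname{Re}s>0\}\), and let \(\mathcal{A}^+\) be the Banach space of absolutely convergent Dirichlet series \(f(s)=\sum_{n\ge1}a_n n^{-s}\) with norm \(\|f\|=\sum_{n\ge1}|a_n|<\infty\). For \(\phi:\mathbb{C}_0\to\mathbb{C}\), the composition operator \(C_\phi\) is \(C_\phi f=f\circ\phi\), that is, \((C_\phi f)(s)=\sum_{n\ge1}a_n n^{-\phi(s)}\) for \(s\in\mathbb{C}_0\). It is called bounded (respectively compact) if this series converges absolutely for every \(f\in\mathcal{A}^+\) and \(s\in\mathbb{C}_0\), if \(C_\phi f\in\mathcal{A}^+\) for every \(f\in\mathcal{A}^+\), and if \(C_\phi:\mathcal{A}^+\to\mathcal{A}^+\) is a bounded (respectively compact) linear operator. Let \(r\ge2\) and \(c_0\ge0\) be integers, let \(c_1\in\mathbb{C}\), let \(c_r,c_{r^2}>0\) be real numbers, and let \[\phi(s)=c_0s+c_1+c_r\,r^{-s}+c_{r^2}\,r^{-2s}.\] (a) If \(\operatorname{Re}c_1>\dfrac{c_r^2}{8c_{r^2}}+c_{r^2}\), then \(C_\phi\)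 is bounded and even compact. (b) Suppose \(c_r\le4c_{r^2}\). If \(C_\phi\) is bounded, then \(\operatorname{Re}c_1\ge\dfrac{c_r^2}{8c_{r^2}}+c_{r^2}\). If \(C_\phi\) is compact, then \(\operatorname{Re}c_1>\dfrac{c_r^2}{8c_{r^2}}+c_{r^2}\). (c) If \(\operatorname{Re}c_1=\dfrac{c_r^2}{8c_{r^2}}+c_{r^2}\), then \(C_\phi\) is bounded if and only if \(c_r\ne4c_{r^2}\). -/

import Mathlib

open scoped ENNReal

noncomputable section

/-- The Wiener-Dirichlet algebra of absolutely convergent Dirichlet series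
`f(s) = ∑_{n ≥ 1} a_n n ^ (-s)`, with norm `∑_{n ≥ 1} |a_n|`. A series is recorded by its
coefficients `a = (a_n)`, which determine it and are determined by it as a function on the
half-plane `re s > 0`. -/
abbrev WienerDirichlet : Type := lp (fun _ : ℕ+ => ℂ) 1

namespace WienerDirichlet

/-- The `n`-th term `a_n n ^ (-s)` of the Dirichlet series `f` at the point `s`. -/
def term (f : WienerDirichlet) (s : ℂ) (n : ℕ+) : ℂ := f n * ((n : ℕ) : ℂ) ^ (-s)

/-- The value `f(s) = ∑_{n ≥ 1} a_n n ^ (-s)`; the series converges absolutely for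
`re s ≥ 0`. -/
def eval (f : WienerDirichlet) (s : ℂ) : ℂ := ∑' n : ℕ+, f.term s n

end WienerDirichlet

/-- `T` is the composition operator `f ↦ f ∘ φ` on the Wiener-Dirichlet algebra: for every `f`
in the algebra and every `s` in the half-plane `re s > 0`, the Dirichlet series of `f` converges
(absolutely) at `φ s`, and its sum `f (φ s)` equals `(T f)(s)`. Convergence for all `f` forces
`re (φ s) ≥ 0`, hence `re (φ s) > 0` throughout the half-plane when `φ` is analytic and
non-constant. -/
def IsCompositionOperator (φ : ℂ → ℂ) (T : WienerDirichlet →L[ℂ] WienerDirichlet) : Prop :=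
  ∀ (f : WienerDirichlet) (s : ℂ), 0 < s.re → HasSum (f.term (φ s)) ((T f).eval s)

/-- The composition operator with symbol `φ` is a well-defined bounded operator of the
Wiener-Dirichlet algebra into itself. -/
def BoundedComposition (φ : ℂ → ℂ) : Prop :=
  ∃ T : WienerDirichlet →L[ℂ] WienerDirichlet, IsCompositionOperator φ T

/-- The composition operator with symbol `φ` is a well-defined compact operator of the
Wiener-Dirichlet algebra into itself. -/
def CompactComposition (φ : ℂ → ℂ) : Prop :=
  ∃ T : WienerDirichlet →L[ℂ] WienerDirichlet, IsCompositionOperator φ T ∧ IsCompactOperator T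

/-- The symbol `φ(s) = c₀ s + c₁ + a r ^ (-s) + b r ^ (-2 s)`. -/
def quadraticSymbol (r c₀ : ℕ) (c₁ : ℂ) (a b : ℝ) (s : ℂ) : ℂ :=
  c₀ * s + c₁ + a * (r : ℂ) ^ (-s) + b * (r : ℂ) ^ (-(2 * s))

end

/-!
With `z = r ^ (-s)` and `L = log n`, the function `n ^ (-φ s)` is `n ^ (-c₁) n ^ (-c₀ s)` times
the entire function `exp (-L (a z + b z ^ 2))` of `z`, so boundedness means that its Taylor
coefficients have `ℓ¹` norm `O(n ^ re c₁)` and compactness that they have `ℓ¹` norm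
`o(n ^ re c₁)`. On the unit circle its maximal modulus is at most `n ^ (a ^ 2 / (8 b) + b)`,
attained when `|a| ≤ 4 b`: testing at such a point gives the necessary conditions, and a Cauchy
estimate on a slightly larger circle gives compactness above this threshold.

At the threshold with `|a| ≠ 4 b`, the maximum is nondegenerate, the modulus is a Gaussian of width
`L ^ (-1 / 2)`, and the Taylor coefficients spread over about `L ^ (1 / 2)` indices, so that
Cauchy-Schwarz bounds their `ℓ¹` norm by a multiple of the maximum. If `|a| = 4 b`, the exponent is
purely imaginary to third order at the maximum, so for large `n` the values of `n ^ (-φ)` at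
equally spaced points of a short arc follow a chirp `exp (i π j ^ 2 / N)` up to a linear phase.
Correlating with the conjugate chirp gives a functional of norm `O(N ^ (3 / 2))` on the algebra
(Parseval for the discrete Fourier transform) that takes modulus about `N ^ 2` on `n ^ (-φ)`.
-/

open Filter Topology MeasureTheory
open scoped Real ComplexConjugate

section AbsolutelySummable

variable {ι 𝕜 E : Type*} [NontriviallyNormedField 𝕜] [NormedAddCommGroup E] [NormedSpace 𝕜 E]

theorem summable_norm_of_l1 (f : lp (fun _ : ι => E) 1) : Summable fun i => ‖f i‖ := by
  simpa using (lp.memℓp f).summable (by norm_num)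

theorem l1_norm_eq_tsum (f : lp (fun _ : ι => E) 1) : ‖f‖ = ∑' i, ‖f i‖ := by
  simpa using lp.norm_eq_tsum_rpow (by norm_num) f

theorem norm_l1_smul_le {v : ι → E} {C : ℝ} (hC : ∀ i, ‖v i‖ ≤ C)
    (f : lp (fun _ : ι => 𝕜) 1) (i : ι) : ‖f i • v i‖ ≤ ‖f i‖ * C := by
  rw [norm_smul]
  exact mul_le_mul_of_nonneg_left (hC i) (norm_nonneg _)

theorem summable_l1_smul [CompleteSpace E] {v : ι → E} {C : ℝ} (hC : ∀ i, ‖v i‖ ≤ C)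
    (f : lp (fun _ : ι => 𝕜) 1) : Summable fun i => f i • v i :=
  .of_norm_bounded ((summable_norm_of_l1 f).mul_right C) (norm_l1_smul_le hC f)

/-- The synthesis operator `f ↦ ∑ i, f i • v i` on `ℓ¹` of a bounded family `v` in a Banach space:
the continuous linear map that sends the `i`-th basis vector to `v i`. -/
noncomputable def l1Synthesis (𝕜 : Type*) [NontriviallyNormedField 𝕜] [NormedSpace 𝕜 E]
    [CompleteSpace E] (v : ι → E) (C : ℝ) (hC : ∀ i, ‖v i‖ ≤ C) :
    lp (fun _ : ι => 𝕜) 1 →L[𝕜] E :=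
  LinearMap.mkContinuous
    { toFun := fun f => ∑' i, f i • v i
      map_add' := fun f g => by
        simp only [← (summable_l1_smul hC f).tsum_add (summable_l1_smul hC g), lp.coeFn_add,
          Pi.add_apply, add_smul]
      map_smul' := fun c f => by
        simp only [RingHom.id_apply, ← (summable_l1_smul hC f).tsum_const_smul, lp.coeFn_smul,
          Pi.smul_apply, smul_assoc] } C
    fun f => by
      rw [mul_comm, l1_norm_eq_tsum f, ← tsum_mul_right]
      exact tsum_of_norm_bounded ((summable_norm_of_l1 f).mul_right C).hasSum (norm_l1_smul_le hC f)

theorem hasSum_l1Synthesis [CompleteSpace E] {v : ι → E} {C : ℝ} (hC : ∀ i, ‖v i‖ ≤ C)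
    (f : lp (fun _ : ι => 𝕜) 1) :
    HasSum (fun i => f i • v i) (l1Synthesis 𝕜 v C hC f) :=
  (summable_l1_smul hC f).hasSum

variable [DecidableEq ι]

theorem l1Synthesis_single [CompleteSpace E] {v : ι → E} {C : ℝ} (hC : ∀ i, ‖v i‖ ≤ C) (i : ι) :
    l1Synthesis 𝕜 v C hC (lp.single 1 i 1) = v i := by
  refine (hasSum_l1Synthesis hC _).unique ?_
  simpa [lp.coeFn_single] using hasSum_single (f := fun j => (Pi.single i 1 : ι → 𝕜) j • v j) i
    fun j hj => by rw [Pi.single_eq_of_ne hj, zero_smul]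

theorem l1_hasSum_apply_single (T : lp (fun _ : ι => 𝕜) 1 →L[𝕜] E) (f : lp (fun _ : ι => 𝕜) 1) :
    HasSum (fun i => f i • T (lp.single 1 i 1)) (T f) := by
  refine ((lp.hasSum_single ENNReal.one_ne_top f).mapL T).congr_fun fun i => ?_
  rw [← map_smul, ← lp.single_smul, smul_eq_mul, mul_one]

theorem norm_l1_apply_le (T : lp (fun _ : ι => 𝕜) 1 →L[𝕜] E) {B : ℝ}
    (hT : ∀ i, ‖T (lp.single 1 i 1)‖ ≤ B) (f : lp (fun _ : ι => 𝕜) 1) : ‖T f‖ ≤ ‖f‖ * B := by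
  rw [← (l1_hasSum_apply_single T f).tsum_eq, l1_norm_eq_tsum f, ← tsum_mul_right]
  exact tsum_of_norm_bounded ((summable_norm_of_l1 f).mul_right B).hasSum (norm_l1_smul_le hT f)

/-- The coordinate projection of `ℓ¹` onto the span of the basis vectors with index in `S`. -/
noncomputable def l1Truncation (𝕜 : Type*) [NontriviallyNormedField 𝕜] (S : Finset ι) :
    lp (fun _ : ι => 𝕜) 1 →L[𝕜] lp (fun _ : ι => 𝕜) 1 :=
  ∑ i ∈ S, (lp.evalCLM 𝕜 (fun _ : ι => 𝕜) 1 i).smulRight (lp.single 1 i 1)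

theorem l1Truncation_single (S : Finset ι) (i : ι) :
    l1Truncation 𝕜 S (lp.single 1 i 1) = if i ∈ S then lp.single 1 i 1 else 0 := by
  have heval (j : ι) : lp.evalCLM 𝕜 (fun _ : ι => 𝕜) 1 j (lp.single 1 i 1) =
      if j = i then 1 else 0 := Pi.single_apply i (1 : 𝕜) j
  simp [l1Truncation, heval, ite_smul]

theorem isCompactOperator_l1Truncation [LocallyCompactSpace 𝕜] (S : Finset ι) :
    IsCompactOperator (l1Truncation 𝕜 S) := by
  refine Submodule.sum_mem (compactOperator (RingHom.id 𝕜) _ _) fun i _ => ?_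
  exact (isCompactOperator_of_locallyCompactSpace_dom (M₂ := 𝕜)
    (lp.evalCLM 𝕜 (fun _ : ι => 𝕜) 1 i)).clm_comp (ContinuousLinearMap.toSpanSingleton 𝕜 _)

theorem isCompactOperator_of_tendsto_single [LocallyCompactSpace 𝕜] [CompleteSpace E]
    (T : lp (fun _ : ι => 𝕜) 1 →L[𝕜] E)
    (hT : Tendsto (fun i => ‖T (lp.single 1 i 1)‖) cofinite (𝓝 0)) : IsCompactOperator T := by
  refine isCompactOperator_of_tendsto (l := (atTop : Filter (Finset ι)))
    (F := fun S => T ∘L l1Truncation 𝕜 S) ?_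
    (Eventually.of_forall fun S => (isCompactOperator_l1Truncation S).clm_comp T)
  refine Metric.tendsto_nhds.2 fun ε hε => ?_
  have hfin : {i | ¬ ‖T (lp.single 1 i 1)‖ < ε / 2}.Finite :=
    eventually_cofinite.1 (hT.eventually (gt_mem_nhds (half_pos hε)))
  filter_upwards [eventually_ge_atTop hfin.toFinset] with S hS
  refine lt_of_le_of_lt ?_ (half_lt_self hε)
  rw [dist_comm, dist_eq_norm]
  refine ContinuousLinearMap.opNorm_le_bound _ (half_pos hε).le fun f => ?_
  rw [mul_comm]
  refine norm_l1_apply_le _ (fun i => ?_) f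
  by_cases hi : i ∈ S
  · simp [l1Truncation_single, hi, (half_pos hε).le]
  · have : ‖T (lp.single 1 i 1)‖ < ε / 2 := by
      by_contra h
      exact hi (hS (hfin.mem_toFinset.2 h))
    simpa [l1Truncation_single, hi] using this.le

end AbsolutelySummable

namespace WienerDirichlet

theorem norm_natCast_cpow_neg (n : ℕ+) (s : ℂ) :
    ‖((n : ℕ) : ℂ) ^ (-s)‖ = Real.exp (-(Real.log n * s.re)) := by
  rw [Complex.norm_natCast_cpow_of_pos n.pos, Real.rpow_def_of_pos (Nat.cast_pos.2 n.pos),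
    Complex.neg_re, mul_neg]

theorem norm_natCast_cpow_neg_le_one {s : ℂ} (hs : 0 ≤ s.re) (n : ℕ+) :
    ‖((n : ℕ) : ℂ) ^ (-s)‖ ≤ 1 := by
  rw [norm_natCast_cpow_neg, Real.exp_le_one_iff, neg_nonpos]
  exact mul_nonneg (Real.log_nonneg (Nat.one_le_cast.2 n.pos)) hs

/-- Evaluation at a point of the closed right half-plane, as a continuous linear functional. -/
noncomputable def evalCLM (s : ℂ) (hs : 0 ≤ s.re) : WienerDirichlet →L[ℂ] ℂ :=
  l1Synthesis ℂ (fun n : ℕ+ => ((n : ℕ) : ℂ) ^ (-s)) 1 (norm_natCast_cpow_neg_le_one hs)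

@[simp] theorem evalCLM_apply (s : ℂ) (hs : 0 ≤ s.re) (f : WienerDirichlet) :
    evalCLM s hs f = f.eval s := rfl

/-- The monomial `n ^ (-s)`. -/
noncomputable def monomial (n : ℕ+) : WienerDirichlet := lp.single 1 n 1

theorem norm_monomial (n : ℕ+) : ‖monomial n‖ = 1 := by
  rw [monomial, lp.norm_single one_pos, norm_one]

theorem hasSum_term_monomial (n : ℕ+) (s : ℂ) :
    HasSum ((monomial n).term s) (((n : ℕ) : ℂ) ^ (-s)) := by
  simpa [term, monomial] using hasSum_single (f := (monomial n).term s) n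
    fun m hm => by simp [term, monomial, hm]

theorem eval_monomial (n : ℕ+) (s : ℂ) : (monomial n).eval s = ((n : ℕ) : ℂ) ^ (-s) :=
  (hasSum_term_monomial n s).tsum_eq

theorem norm_eval_le (f : WienerDirichlet) {s : ℂ} (hs : 0 ≤ s.re) : ‖f.eval s‖ ≤ ‖f‖ := by
  rw [← evalCLM_apply s hs, ← mul_one ‖f‖]
  refine norm_l1_apply_le _ (fun n => ?_) f
  rw [← monomial, evalCLM_apply, eval_monomial]
  exact norm_natCast_cpow_neg_le_one hs n

theorem norm_sum_eval_le {ι : Type*} {I : Finset ι} {α s : ι → ℂ} (hs : ∀ i, 0 ≤ (s i).re)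
    {B : ℝ} (hB : ∀ n : ℕ+, ‖∑ i ∈ I, α i * ((n : ℕ) : ℂ) ^ (-s i)‖ ≤ B) (f : WienerDirichlet) :
    ‖∑ i ∈ I, α i * f.eval (s i)‖ ≤ ‖f‖ * B := by
  have h := norm_l1_apply_le (∑ i ∈ I, α i • evalCLM (s i) (hs i)) (B := B) (fun n => ?_) f
  · simpa using h
  · rw [← monomial]
    simpa [eval_monomial] using hB n

theorem continuousOn_eval (f : WienerDirichlet) : ContinuousOn f.eval {s | 0 ≤ s.re} := by
  refine continuousOn_tsum (fun n => Continuous.continuousOn ?_) (summable_norm_of_l1 f)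
    fun n s hs => ?_
  · exact continuous_const.mul (continuous_neg.const_cpow (.inl (Nat.cast_ne_zero.2 n.ne_zero)))
  · rw [term, norm_mul]
    exact mul_le_of_le_one_right (norm_nonneg _) (norm_natCast_cpow_neg_le_one hs n)

theorem eval_eq_of_forall_re_pos {f : WienerDirichlet} {g : ℂ → ℂ}
    (hg : ContinuousOn g {s | 0 ≤ s.re}) (h : ∀ s : ℂ, 0 < s.re → f.eval s = g s) {s : ℂ}
    (hs : 0 ≤ s.re) : f.eval s = g s := by
  have hsubset : {s : ℂ | 0 < s.re} ⊆ {s | 0 ≤ s.re} := Set.ofPred_subset_ofPred.2 fun _ => le_of_lt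
  have hclosure : {s : ℂ | 0 ≤ s.re} ⊆ closure {s | 0 < s.re} := by
    rw [Complex.closure_setOfPred_lt_re]
  exact Set.EqOn.of_subset_closure h f.continuousOn_eval hg hsubset hclosure hs

theorem exists_eval_eq_mul_powerSeries {d : ℕ → ℂ} (hd : Summable fun k => ‖d k‖) (m r : ℕ+) :
    ∃ f : WienerDirichlet, ‖f‖ ≤ ∑' k, ‖d k‖ ∧ ∀ s : ℂ, 0 ≤ s.re →
      HasSum (fun k => ((m : ℕ) : ℂ) ^ (-s) * (d k * (((r : ℕ) : ℂ) ^ (-s)) ^ k)) (f.eval s) := by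
  have hnorm (k : ℕ) : ‖d k • monomial (m * r ^ k)‖ = ‖d k‖ := by
    rw [norm_smul, norm_monomial, mul_one]
  have hsum : Summable fun k => d k • monomial (m * r ^ k) := .of_norm (by simpa only [hnorm])
  refine ⟨∑' k, d k • monomial (m * r ^ k),
    tsum_of_norm_bounded hd.hasSum fun k => (hnorm k).le, fun s hs => ?_⟩
  refine (hsum.hasSum.mapL (evalCLM s hs)).congr_fun fun k => ?_
  rw [map_smul, evalCLM_apply, eval_monomial, smul_eq_mul, PNat.mul_coe, Nat.cast_mul,
    Complex.natCast_mul_natCast_cpow, PNat.pow_coe, Nat.cast_pow,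
    ← Complex.natCast_cpow_natCast_mul, Complex.cpow_nat_mul, mul_left_comm]

theorem tendsto_log_cofinite : Tendsto (fun n : ℕ+ => Real.log n) cofinite atTop :=
  Real.tendsto_log_atTop.comp <| tendsto_natCast_atTop_atTop.comp <|
    Nat.cofinite_eq_atTop ▸ PNat.coe_injective.tendsto_cofinite

end WienerDirichlet

open WienerDirichlet

section Criteria

variable {φ : ℂ → ℂ}

theorem isCompositionOperator_l1Synthesis {v : ℕ+ → WienerDirichlet} {C : ℝ}
    (hC : ∀ n, ‖v n‖ ≤ C)
    (hv : ∀ n s, 0 < s.re → (v n).eval s = ((n : ℕ) : ℂ) ^ (-φ s)) :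
    IsCompositionOperator φ (l1Synthesis ℂ v C hC) := by
  intro f s hs
  refine ((hasSum_l1Synthesis hC f).mapL (evalCLM s hs.le)).congr_fun fun n => ?_
  rw [term, map_smul, evalCLM_apply, hv n s hs, smul_eq_mul]

theorem boundedComposition_of_isBoundedUnder_cofinite {v : ℕ+ → WienerDirichlet}
    (hv : ∀ n s, 0 < s.re → (v n).eval s = ((n : ℕ) : ℂ) ^ (-φ s))
    (hbdd : IsBoundedUnder (· ≤ ·) cofinite fun n => ‖v n‖) : BoundedComposition φ := by
  obtain ⟨C, hC⟩ := hbdd.bddAbove_range_of_cofinite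
  exact ⟨_, isCompositionOperator_l1Synthesis (fun n => hC ⟨n, rfl⟩) hv⟩

theorem compactComposition_of_tendsto_cofinite {v : ℕ+ → WienerDirichlet}
    (hv : ∀ n s, 0 < s.re → (v n).eval s = ((n : ℕ) : ℂ) ^ (-φ s))
    (hlim : Tendsto (fun n => ‖v n‖) cofinite (𝓝 0)) : CompactComposition φ := by
  obtain ⟨C, hC⟩ := hlim.bddAbove_range_of_cofinite
  have hC' (n) : ‖v n‖ ≤ C := hC ⟨n, rfl⟩
  refine ⟨_, isCompositionOperator_l1Synthesis hC' hv, isCompactOperator_of_tendsto_single _ ?_⟩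
  simpa only [l1Synthesis_single] using hlim

theorem CompactComposition.boundedComposition (h : CompactComposition φ) : BoundedComposition φ :=
  h.imp fun _ => And.left

theorem IsCompositionOperator.eval_map_monomial {T : WienerDirichlet →L[ℂ] WienerDirichlet}
    (hT : IsCompositionOperator φ T) (hφ : Continuous φ) (n : ℕ+) {s : ℂ} (hs : 0 ≤ s.re) :
    (T (monomial n)).eval s = ((n : ℕ) : ℂ) ^ (-φ s) := by
  refine eval_eq_of_forall_re_pos (g := fun s => ((n : ℕ) : ℂ) ^ (-φ s)) ?_
    (fun s hs => (hT _ s hs).unique (hasSum_term_monomial n _)) hs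
  exact (hφ.neg.const_cpow (.inl (Nat.cast_ne_zero.2 n.ne_zero))).continuousOn

theorem BoundedComposition.re_nonneg (h : BoundedComposition φ) (hφ : Continuous φ) {s : ℂ}
    (hs : 0 ≤ s.re) : 0 ≤ (φ s).re := by
  obtain ⟨T, hT⟩ := h
  by_contra! hneg
  have hbdd (n : ℕ+) : Real.exp (-(Real.log n * (φ s).re)) ≤ ‖T‖ := by
    rw [← norm_natCast_cpow_neg, ← hT.eval_map_monomial hφ n hs]
    exact (norm_eval_le _ hs).trans (T.unit_le_opNorm _ (norm_monomial n).le)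
  have hlim : Tendsto (fun n : ℕ+ => Real.exp (Real.log n * -(φ s).re)) cofinite atTop :=
    Real.tendsto_exp_atTop.comp (tendsto_log_cofinite.atTop_mul_const (neg_pos.2 hneg))
  obtain ⟨n, hn⟩ := (hlim.eventually_gt_atTop ‖T‖).exists
  exact (mul_neg (Real.log n) _ ▸ hn).not_ge (hbdd n)

/-- Otherwise `T` would map some subnet of the monomials to a limit that vanishes on the open
half-plane but is unimodular at `s`. -/
theorem CompactComposition.re_pos (h : CompactComposition φ) (hφ : Continuous φ)
    (hpos : ∀ s : ℂ, 0 < s.re → 0 < (φ s).re) {s : ℂ} (hs : 0 ≤ s.re) : 0 < (φ s).re := by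
  refine (h.boundedComposition.re_nonneg hφ hs).lt_of_ne' fun hzero => ?_
  obtain ⟨T, hT, hcomp⟩ := h
  obtain ⟨g, -, hg⟩ := (hcomp.isCompact_closure_image_closedBall 1).ultrafilter_le_nhds
    ((hyperfilter ℕ+).map fun n => T (monomial n))
    (le_principal_iff.2 <| mem_map.2 <| univ_mem' fun n =>
      subset_closure ⟨_, by simp [norm_monomial], rfl⟩)
  have hnorm {z : ℂ} (hz : 0 ≤ z.re) : Tendsto (fun n : ℕ+ => Real.exp (-(Real.log n * (φ z).re)))
      (hyperfilter ℕ+) (𝓝 ‖g.eval z‖) := by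
    simp only [← norm_natCast_cpow_neg, ← hT.eval_map_monomial hφ _ hz]
    exact ((evalCLM z hz).continuous.norm.tendsto g).comp hg
  have hg_zero (z : ℂ) (hz : 0 < z.re) : g.eval z = 0 := by
    refine norm_eq_zero.1 (tendsto_nhds_unique (hnorm hz.le) ?_)
    exact Real.tendsto_exp_neg_atTop_nhds_zero.comp
      ((tendsto_log_cofinite.mono_left hyperfilter_le_cofinite).atTop_mul_const (hpos z hz))
  have hg_one : ‖g.eval s‖ = 1 := by
    refine tendsto_nhds_unique (hnorm hs) ?_
    simp [hzero]
  rw [eval_eq_of_forall_re_pos (g := 0) continuousOn_const hg_zero hs] at hg_one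
  simp at hg_one

end Criteria

section Symbol

variable {r c₀ : ℕ} {c₁ : ℂ} {a b : ℝ}

theorem re_quadratic_eq (a : ℝ) (hb : b ≠ 0) (z : ℂ) :
    (a * z + b * z ^ 2).re = 2 * b * (z.re + a / (4 * b)) ^ 2 - a ^ 2 / (8 * b) - b * ‖z‖ ^ 2 := by
  rw [Complex.sq_norm, Complex.normSq_apply, sq z]
  simp only [Complex.add_re, Complex.mul_re, Complex.mul_im, Complex.ofReal_re, Complex.ofReal_im]
  field_simp
  ring

theorem quadraticSymbol_eq (r c₀ : ℕ) (c₁ : ℂ) (a b : ℝ) (s : ℂ) :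
    quadraticSymbol r c₀ c₁ a b s =
      c₀ * s + c₁ + (a * (r : ℂ) ^ (-s) + b * ((r : ℂ) ^ (-s)) ^ 2) := by
  rw [quadraticSymbol, ← mul_neg, Complex.cpow_ofNat_mul]
  ring

theorem re_quadraticSymbol (r c₀ : ℕ) (c₁ : ℂ) (a : ℝ) (hb : b ≠ 0) (s : ℂ) :
    (quadraticSymbol r c₀ c₁ a b s).re = c₀ * s.re + (c₁.re - (a ^ 2 / (8 * b) + b)) +
      (2 * b * (((r : ℂ) ^ (-s)).re + a / (4 * b)) ^ 2 + b * (1 - ‖(r : ℂ) ^ (-s)‖ ^ 2)) := by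
  rw [quadraticSymbol_eq, Complex.add_re, re_quadratic_eq a hb, Complex.add_re,
    ← Complex.ofReal_natCast, Complex.re_ofReal_mul]
  ring

theorem continuous_quadraticSymbol (hr : r ≠ 0) : Continuous (quadraticSymbol r c₀ c₁ a b) := by
  have hr' : (r : ℂ) ≠ 0 := Nat.cast_ne_zero.2 hr
  unfold quadraticSymbol
  exact (((by fun_prop : Continuous fun s : ℂ => c₀ * s + c₁)).add
    (continuous_const.mul (continuous_neg.const_cpow (.inl hr')))).add
    (continuous_const.mul ((by fun_prop : Continuous fun s : ℂ => -(2 * s)).const_cpow (.inl hr')))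

/-- The point `s` of the imaginary axis at which `r ^ (-s) = exp (i θ)`. -/
noncomputable def boundaryPoint (r : ℕ) (θ : ℝ) : ℂ := -((θ / Real.log r : ℝ) * Complex.I)

theorem boundaryPoint_re (r : ℕ) (θ : ℝ) : (boundaryPoint r θ).re = 0 := by
  simp [boundaryPoint, -Complex.ofReal_div]

theorem boundaryPoint_add_mul (r : ℕ) (t h : ℝ) (j : ℕ) :
    boundaryPoint r (t + j * h) = boundaryPoint r t + j * boundaryPoint r h := by
  simp only [boundaryPoint, add_div, mul_div_assoc, Complex.ofReal_add, Complex.ofReal_mul,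
    Complex.ofReal_natCast]
  ring

theorem natCast_cpow_neg_boundaryPoint (hr : 2 ≤ r) (θ : ℝ) :
    (r : ℂ) ^ (-boundaryPoint r θ) = Complex.exp (θ * Complex.I) := by
  have hlog : (Real.log r : ℂ) ≠ 0 :=
    Complex.ofReal_ne_zero.2 (Real.log_pos (Nat.one_lt_cast.2 hr)).ne'
  rw [Complex.cpow_def_of_ne_zero (Nat.cast_ne_zero.2 (by lia)), ← Complex.natCast_log,
    boundaryPoint, neg_neg, Complex.ofReal_div]
  field_simp

theorem re_quadraticSymbol_boundaryPoint (hr : 2 ≤ r) (c₀ : ℕ) (c₁ : ℂ) (a : ℝ) (hb : b ≠ 0)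
    (θ : ℝ) : (quadraticSymbol r c₀ c₁ a b (boundaryPoint r θ)).re =
      c₁.re - (a ^ 2 / (8 * b) + b) + 2 * b * (Real.cos θ + a / (4 * b)) ^ 2 := by
  rw [re_quadraticSymbol r c₀ c₁ a hb, natCast_cpow_neg_boundaryPoint hr, boundaryPoint_re,
    Complex.norm_exp_ofReal_mul_I, Complex.exp_ofReal_mul_I_re]
  ring

theorem exists_re_quadraticSymbol_boundaryPoint (hr : 2 ≤ r) (c₀ : ℕ) (c₁ : ℂ) (hb : 0 < b)
    (hab : |a| ≤ 4 * b) : ∃ θ, (quadraticSymbol r c₀ c₁ a b (boundaryPoint r θ)).re =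
      c₁.re - (a ^ 2 / (8 * b) + b) := by
  obtain ⟨hneg, hpos⟩ := abs_le.1 hab
  refine ⟨Real.arccos (-(a / (4 * b))), ?_⟩
  rw [re_quadraticSymbol_boundaryPoint hr c₀ c₁ a hb.ne', Real.cos_arccos, neg_add_cancel]
  · ring
  · rwa [neg_le_neg_iff, div_le_one (by positivity)]
  · rwa [neg_le, le_div_iff₀ (by positivity), neg_one_mul]

theorem re_quadraticSymbol_pos (hr : 2 ≤ r) (c₀ : ℕ) (hb : 0 < b)
    (hc : a ^ 2 / (8 * b) + b ≤ c₁.re) {s : ℂ} (hs : 0 < s.re) :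
    0 < (quadraticSymbol r c₀ c₁ a b s).re := by
  have hnorm : ‖(r : ℂ) ^ (-s)‖ < 1 := by
    rw [Complex.norm_natCast_cpow_of_pos (by lia)]
    exact Real.rpow_lt_one_of_one_lt_of_neg (Nat.one_lt_cast.2 hr) (neg_neg_of_pos hs)
  have hgap : 0 < b * (1 - ‖(r : ℂ) ^ (-s)‖ ^ 2) :=
    mul_pos hb (sub_pos.2 (pow_lt_one₀ (norm_nonneg _) hnorm two_ne_zero))
  rw [re_quadraticSymbol r c₀ c₁ a hb.ne']
  have := sub_nonneg.2 hc
  positivity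

theorem le_re_of_boundedComposition (hr : 2 ≤ r) (hb : 0 < b) (hab : |a| ≤ 4 * b)
    (h : BoundedComposition (quadraticSymbol r c₀ c₁ a b)) : a ^ 2 / (8 * b) + b ≤ c₁.re := by
  obtain ⟨θ, hθ⟩ := exists_re_quadraticSymbol_boundaryPoint hr c₀ c₁ hb hab
  rw [← sub_nonneg, ← hθ]
  exact h.re_nonneg (continuous_quadraticSymbol (by lia)) (boundaryPoint_re r θ).ge

theorem lt_re_of_compactComposition (hr : 2 ≤ r) (hb : 0 < b) (hab : |a| ≤ 4 * b)
    (h : CompactComposition (quadraticSymbol r c₀ c₁ a b)) : a ^ 2 / (8 * b) + b < c₁.re := by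
  obtain ⟨θ, hθ⟩ := exists_re_quadraticSymbol_boundaryPoint hr c₀ c₁ hb hab
  have hle := le_re_of_boundedComposition hr hb hab h.boundedComposition
  rw [← sub_pos, ← hθ]
  exact h.re_pos (continuous_quadraticSymbol (by lia))
    (fun _ => re_quadraticSymbol_pos hr c₀ hb hle) (boundaryPoint_re r θ).ge

/-- The entire function of `z = r ^ (-s)` that carries the non-monomial factor of
`n ^ (-φ s)`, with `L = log n`. -/
noncomputable def quadraticExp (a b L : ℝ) (z : ℂ) : ℂ := Complex.exp (-L * (a * z + b * z ^ 2))

theorem norm_quadraticExp (a : ℝ) (hb : b ≠ 0) (L : ℝ) (z : ℂ) :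
    ‖quadraticExp a b L z‖ = Real.exp (L * (a ^ 2 / (8 * b) + b * ‖z‖ ^ 2) -
      2 * b * L * (z.re + a / (4 * b)) ^ 2) := by
  rw [quadraticExp, Complex.norm_exp, ← Complex.ofReal_neg, Complex.re_ofReal_mul,
    re_quadratic_eq a hb]
  congr 1
  ring

theorem natCast_cpow_neg_quadraticSymbol (n : ℕ+) (r c₀ : ℕ) (c₁ : ℂ) (a b : ℝ) (s : ℂ) :
    ((n : ℕ) : ℂ) ^ (-quadraticSymbol r c₀ c₁ a b s) =
      ((n : ℕ) : ℂ) ^ (-c₁) * (((n ^ c₀ : ℕ+) : ℕ) : ℂ) ^ (-s) *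
        quadraticExp a b (Real.log n) ((r : ℂ) ^ (-s)) := by
  have hn : ((n : ℕ) : ℂ) ≠ 0 := Nat.cast_ne_zero.2 n.ne_zero
  rw [PNat.pow_coe, Nat.cast_pow, ← Complex.natCast_cpow_natCast_mul, quadraticSymbol_eq,
    quadraticExp, Complex.natCast_log, neg_mul, ← mul_neg, ← Complex.cpow_def_of_ne_zero hn,
    ← Complex.cpow_add _ _ hn, ← Complex.cpow_add _ _ hn]
  congr 1
  ring

end Symbol

section PowerSeries

theorem hasSum_sq_norm_circleAverage {d : ℕ → ℂ} {G : ℂ → ℂ}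
    (hG : ∀ z : ℂ, ‖z‖ = 1 → HasSum (fun k => d k * z ^ k) (G z)) :
    HasSum (fun k => ‖d k‖ ^ 2) (Real.circleAverage (fun z => ‖G z‖ ^ 2) 0 1) := by
  have hnorm (θ : ℝ) : ‖circleMap 0 1 θ‖ = 1 := by simp
  have hd : Summable fun k => ‖d k‖ := by simpa using (hG 1 norm_one).summable.norm
  let p (N : ℕ) : Polynomial ℂ := ∑ k ∈ Finset.range N, Polynomial.monomial k (d k)
  have hp_eval (N : ℕ) (z : ℂ) : (p N).eval z = ∑ k ∈ Finset.range N, d k * z ^ k := by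
    simp [p, Polynomial.eval_finsetSum]
  have hp_parseval (N : ℕ) : ∑ k ∈ Finset.range N, ‖d k‖ ^ 2 =
      Real.circleAverage (fun z => ‖(p N).eval z‖ ^ 2) 0 1 := by
    have hcoeff (k : ℕ) : (p N).coeff k = if k < N then d k else 0 := by
      simp [p, Polynomial.finsetSum_coeff, Polynomial.coeff_monomial]
    rw [← Polynomial.sum_sq_norm_coeff_eq_circleAverage]
    refine (Finset.sum_congr rfl fun k hk => ?_).trans
      (Finset.sum_subset (fun k hk => ?_) fun k _ hk => ?_).symm
    · rw [hcoeff, if_pos (Finset.mem_range.1 hk)]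
    · by_contra hkN
      exact Polynomial.mem_support_iff.1 hk ((hcoeff k).trans (if_neg (by simpa using hkN)))
    · simp [Polynomial.notMem_support_iff.1 hk]
  refine (hasSum_iff_tendsto_nat_of_nonneg (fun _ => by positivity) _).2 ?_
  simp only [hp_parseval, Real.circleAverage_def]
  refine Tendsto.const_smul ?_ _
  refine intervalIntegral.tendsto_integral_filter_of_dominated_convergence
    (fun _ => (∑' k, ‖d k‖) ^ 2) (.of_forall fun N => ?_) (.of_forall fun N => ae_of_all _ ?_)
    (by simp) (ae_of_all _ ?_)
  · exact Continuous.aestronglyMeasurable (by fun_prop)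
  · intro θ _
    rw [norm_pow, norm_norm, hp_eval]
    gcongr
    calc ‖∑ k ∈ Finset.range N, d k * circleMap 0 1 θ ^ k‖
        ≤ ∑ k ∈ Finset.range N, ‖d k‖ :=
          norm_sum_le_of_le _ fun k _ => by rw [norm_mul, norm_pow, hnorm, one_pow, mul_one]
      _ ≤ ∑' k, ‖d k‖ := hd.sum_le_tsum _ fun _ _ => norm_nonneg _
  · intro θ _
    simp only [hp_eval]
    exact ((hG _ (hnorm θ)).tendsto_sum_nat.norm.pow 2)

theorem div_le_arctan_add_sub_arctan {h : ℝ} (hh : 0 < h) (u : ℝ) :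
    h / (2 * (1 + h ^ 2) * (1 + u ^ 2)) ≤ Real.arctan (u + h) - Real.arctan u := by
  obtain ⟨ξ, hξ, hslope⟩ := exists_hasDerivAt_eq_slope Real.arctan (fun x => 1 / (1 + x ^ 2))
    (lt_add_of_pos_right u hh) Real.continuous_arctan.continuousOn
    fun x _ => Real.hasDerivAt_arctan x
  rw [add_sub_cancel_left, eq_div_iff hh.ne'] at hslope
  have hξ_sq : (ξ - u) ^ 2 ≤ h ^ 2 := by nlinarith [hξ.1, hξ.2]
  rw [← hslope, one_div, inv_mul_eq_div]
  gcongr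
  nlinarith [sq_nonneg (ξ - 2 * u), mul_nonneg (sq_nonneg h) (sq_nonneg u)]

theorem sum_inv_one_add_sq_le {h : ℝ} (hh : 0 < h) (x : ℝ) (N : ℕ) :
    ∑ k ∈ Finset.range N, (1 + h ^ 2 * (k - x) ^ 2)⁻¹ ≤ 2 * π * (1 + h ^ 2) / h := by
  have hterm (k : ℕ) : (1 + h ^ 2 * (k - x) ^ 2)⁻¹ ≤ 2 * (1 + h ^ 2) / h *
      (Real.arctan (h * ((k + 1 : ℕ) - x)) - Real.arctan (h * (k - x))) := by
    have hstep : h * ((k + 1 : ℕ) - x) = h * (k - x) + h := by push_cast; ring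
    calc (1 + h ^ 2 * (k - x) ^ 2)⁻¹
        = 2 * (1 + h ^ 2) / h * (h / (2 * (1 + h ^ 2) * (1 + (h * (k - x)) ^ 2))) := by
          rw [mul_pow]
          field_simp
      _ ≤ _ := by
          rw [hstep]
          gcongr
          exact div_le_arctan_add_sub_arctan hh _
  calc _ ≤ ∑ k ∈ Finset.range N, 2 * (1 + h ^ 2) / h *
        (Real.arctan (h * ((k + 1 : ℕ) - x)) - Real.arctan (h * (k - x))) :=
        Finset.sum_le_sum fun k _ => hterm k
    _ = 2 * (1 + h ^ 2) / h * (Real.arctan (h * (N - x)) - Real.arctan (h * ((0 : ℕ) - x))) := by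
        rw [← Finset.mul_sum, Finset.sum_range_sub fun k : ℕ => Real.arctan (h * (k - x))]
    _ ≤ 2 * (1 + h ^ 2) / h * (π / 2 - -(π / 2)) := by
        gcongr
        · exact (Real.arctan_lt_pi_div_two _).le
        · exact (Real.neg_pi_div_two_lt_arctan _).le
    _ = _ := by ring

/-- The `k`-th Taylor coefficient of `G` at the origin. -/
noncomputable def taylorCoeff (G : ℂ → ℂ) (k : ℕ) : ℂ :=
  (k.factorial : ℂ)⁻¹ * iteratedDeriv k G 0

/-- The norm `∑ k, |d k|` of `G = ∑ k, d k z ^ k` in the algebra of absolutely convergent power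
series. -/
noncomputable def taylorNorm (G : ℂ → ℂ) : ℝ := ∑' k, ‖taylorCoeff G k‖

variable {G : ℂ → ℂ}

theorem hasSum_taylorCoeff (hG : Differentiable ℂ G) (z : ℂ) :
    HasSum (fun k => taylorCoeff G k * z ^ k) (G z) := by
  refine (Complex.hasSum_taylorSeries_of_entire hG 0 z).congr_fun fun k => ?_
  simp only [taylorCoeff, sub_zero, smul_eq_mul]
  ring

theorem summable_norm_taylorCoeff (hG : Differentiable ℂ G) :
    Summable fun k => ‖taylorCoeff G k‖ := by
  simpa using (hasSum_taylorCoeff hG 1).summable.norm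

theorem taylorCoeff_deriv (G : ℂ → ℂ) (k : ℕ) :
    taylorCoeff (deriv G) k = (k + 1 : ℕ) * taylorCoeff G (k + 1) := by
  rw [taylorCoeff, taylorCoeff, iteratedDeriv_succ', Nat.factorial_succ, Nat.cast_mul, mul_inv,
    mul_assoc, mul_inv_cancel_left₀ (Nat.cast_ne_zero.2 k.succ_ne_zero)]

theorem hasSum_natCast_mul_taylorCoeff (hG : Differentiable ℂ G) (z : ℂ) :
    HasSum (fun k => k * taylorCoeff G k * z ^ k) (z * deriv G z) := by
  have h := (hasSum_taylorCoeff hG.deriv z).mul_left z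
  rw [← hasSum_nat_add_iff' 1]
  simp only [Finset.sum_range_one, Nat.cast_zero, zero_mul, sub_zero]
  refine h.congr_fun fun k => ?_
  rw [taylorCoeff_deriv]
  ring

theorem taylorNorm_le_of_forall_mem_sphere {ρ C : ℝ} (hG : Differentiable ℂ G) (hρ : 1 < ρ)
    (hC : ∀ z ∈ Metric.sphere (0 : ℂ) ρ, ‖G z‖ ≤ C) : taylorNorm G ≤ C * (1 - ρ⁻¹)⁻¹ := by
  have hρ₀ : 0 < ρ := one_pos.trans hρ
  refine hasSum_le (fun k => ?_) (summable_norm_taylorCoeff hG).hasSum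
    ((hasSum_geometric_of_lt_one (inv_nonneg.2 hρ₀.le) (inv_lt_one_of_one_lt₀ hρ)).mul_left C)
  have hcauchy := Complex.norm_iteratedDeriv_le_of_forall_mem_sphere_norm_le k hρ₀
    hG.diffContOnCl hC
  rw [taylorCoeff, norm_mul, norm_inv, Complex.norm_natCast,
    inv_mul_le_iff₀ (by positivity)]
  exact hcauchy.trans_eq (by rw [inv_pow]; ring)

theorem hasSum_weighted_sq_taylorCoeff (hG : Differentiable ℂ G) (h x : ℝ) :
    HasSum (fun k : ℕ => (1 + h ^ 2 * (k - x) ^ 2) * ‖taylorCoeff G k‖ ^ 2)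
      (Real.circleAverage (fun z => ‖G z‖ ^ 2 + h ^ 2 * ‖z * deriv G z - x * G z‖ ^ 2) 0 1) := by
  have hcont : Continuous G := hG.continuous
  have hcont' : Continuous (deriv G) := hG.deriv.continuous
  have hshift (z : ℂ) : HasSum (fun k => (k * taylorCoeff G k - x * taylorCoeff G k) * z ^ k)
      (z * deriv G z - x * G z) := by
    simpa only [sub_mul, mul_assoc] using
      (hasSum_natCast_mul_taylorCoeff hG z).sub ((hasSum_taylorCoeff hG z).mul_left (x : ℂ))
  have hsum := (hasSum_sq_norm_circleAverage fun z _ => hasSum_taylorCoeff hG z).add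
    ((hasSum_sq_norm_circleAverage fun z _ => hshift z).mul_left (h ^ 2))
  rw [← smul_eq_mul (h ^ 2), ← Real.circleAverage_fun_smul, ← Real.circleAverage_fun_add
    (Continuous.continuousOn (by fun_prop)).circleIntegrable'
    (Continuous.continuousOn (by fun_prop)).circleIntegrable'] at hsum
  refine hsum.congr_fun fun k => ?_
  rw [← sub_mul, norm_mul, ← Complex.ofReal_natCast, ← Complex.ofReal_sub, Complex.norm_real,
    mul_pow, Real.norm_eq_abs, sq_abs]
  ring

/-- A Carlson-type inequality: Cauchy-Schwarz with Lorentzian weights of width `h⁻¹` centred at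
the index `x`, around which the Taylor coefficients are expected to concentrate. -/
theorem taylorNorm_sq_le (hG : Differentiable ℂ G) {h : ℝ} (hh : 0 < h) (x : ℝ) :
    taylorNorm G ^ 2 ≤ 2 * π * (1 + h ^ 2) / h *
      Real.circleAverage (fun z => ‖G z‖ ^ 2 + h ^ 2 * ‖z * deriv G z - x * G z‖ ^ 2) 0 1 := by
  refine le_of_tendsto' ((summable_norm_taylorCoeff hG).hasSum.tendsto_sum_nat.pow 2) fun N => ?_
  calc (∑ k ∈ Finset.range N, ‖taylorCoeff G k‖) ^ 2
      ≤ (∑ k ∈ Finset.range N, (1 + h ^ 2 * (k - x) ^ 2)⁻¹) *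
          ∑ k ∈ Finset.range N, (1 + h ^ 2 * (k - x) ^ 2) * ‖taylorCoeff G k‖ ^ 2 :=
        Finset.sum_sq_le_sum_mul_sum_of_sq_le_mul _ (fun k _ => by positivity)
          (fun k _ => by positivity) fun k _ => by rw [inv_mul_cancel_left₀ (by positivity)]
    _ ≤ _ := mul_le_mul (sum_inv_one_add_sq_le hh x N)
        (sum_le_hasSum _ (fun k _ => by positivity) (hasSum_weighted_sq_taylorCoeff hG h x))
        (by positivity) (by positivity)

end PowerSeries

section GaussianOnCircle

theorem exists_pos_forall_mul_abs_sub_le {s : Set ℝ} {f : ℝ → ℝ} {t d : ℝ} (hs : IsCompact s)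
    (hst : s ∈ 𝓝 t) (hf : ContinuousOn f s) (hd : HasDerivAt f d t) (hd₀ : d ≠ 0)
    (hne : ∀ x ∈ s, x ≠ t → f x ≠ f t) : ∃ c > 0, ∀ x ∈ s, c * |x - t| ≤ |f x - f t| := by
  obtain ⟨c, hc, hle⟩ := hs.exists_forall_le' (a := 0)
    ((continuousOn_dslope hst).2 ⟨hf, hd.differentiableAt⟩).abs fun x hx => abs_pos.2 <| by
      obtain rfl | hxt := eq_or_ne x t
      · rwa [dslope_same, hd.deriv]
      · rw [dslope_of_ne _ hxt, slope_def_field]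
        exact div_ne_zero (sub_ne_zero.2 (hne x hx hxt)) (sub_ne_zero.2 hxt)
  refine ⟨c, hc, fun x hx => ?_⟩
  calc c * |x - t| ≤ |dslope f t x| * |x - t| := by gcongr; exact hle x hx
    _ = |f x - f t| := by rw [← abs_mul, mul_comm, ← smul_eq_mul, sub_smul_dslope]

theorem exists_mul_sq_le_sq_cos_add {q : ℝ} (hq : |q| ≠ 1) :
    ∃ c > 0, ∃ t, ∀ u ∈ Set.Icc 0 π, c * (u - t) ^ 2 ≤ (Real.cos u + q) ^ 2 := by
  suffices h : ∃ c > 0, ∃ t, ∀ u ∈ Set.Icc 0 π, c * |u - t| ≤ |Real.cos u + q| by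
    obtain ⟨c, hc, t, hle⟩ := h
    refine ⟨c ^ 2, by positivity, t, fun u hu => ?_⟩
    rw [← sq_abs (u - t), ← mul_pow, ← sq_abs (Real.cos u + q)]
    exact pow_le_pow_left₀ (by positivity) (hle u hu) 2
  obtain hlt | hgt := hq.lt_or_gt
  · obtain ⟨hneg, hpos⟩ := abs_lt.1 hlt
    have hcos : Real.cos (Real.arccos (-q)) = -q := Real.cos_arccos (by linarith) (by linarith)
    have hmem : Real.arccos (-q) ∈ Set.Ioo 0 π :=
      ⟨Real.arccos_pos.2 (by linarith), Real.arccos_lt_pi.2 (by linarith)⟩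
    obtain ⟨c, hc, hle⟩ := exists_pos_forall_mul_abs_sub_le isCompact_Icc
      (Icc_mem_nhds hmem.1 hmem.2) Real.continuous_cos.continuousOn
      (Real.hasDerivAt_cos _) (neg_ne_zero.2 (Real.sin_pos_of_mem_Ioo hmem).ne')
      fun u hu => Real.injOn_cos.ne hu (Set.Ioo_subset_Icc_self hmem)
    exact ⟨c, hc, _, by simpa only [hcos, sub_neg_eq_add] using hle⟩
  · refine ⟨(|q| - 1) / π, div_pos (sub_pos.2 hgt) Real.pi_pos, 0, fun u hu => ?_⟩
    calc (|q| - 1) / π * |u - 0| ≤ (|q| - 1) / π * π := by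
          rw [sub_zero, abs_of_nonneg hu.1]
          exact mul_le_mul_of_nonneg_left hu.2 (div_nonneg (sub_nonneg.2 hgt.le) Real.pi_pos.le)
      _ = |q| - 1 := div_mul_cancel₀ _ Real.pi_ne_zero
      _ ≤ |q| - |-Real.cos u| := by rw [abs_neg]; gcongr; exact Real.abs_cos_le_one u
      _ ≤ |Real.cos u + q| := by
          rw [add_comm, ← sub_neg_eq_add]
          exact abs_sub_abs_le_abs_sub _ _

theorem circleAverage_comp_re {F : ℝ → ℝ} (hF : Continuous F) :
    Real.circleAverage (fun z => F z.re) 0 1 = π⁻¹ * ∫ u in (0)..π, F (Real.cos u) := by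
  have hint (x y : ℝ) : IntervalIntegrable (fun u => F (Real.cos u)) volume x y :=
    (hF.comp Real.continuous_cos).intervalIntegrable x y
  have hreflect : ∫ u in π..(2 * π), F (Real.cos u) = ∫ u in (0)..π, F (Real.cos u) := by
    have h := intervalIntegral.integral_comp_sub_left (fun u => F (Real.cos u)) (2 * π)
      (a := 0) (b := π)
    simp only [Real.cos_two_pi_sub, sub_zero] at h
    rw [h]
    congr 1
    ring
  have hre (u : ℝ) : (circleMap 0 1 u).re = Real.cos u := by
    simp [circleMap, Complex.exp_ofReal_mul_I_re]
  simp only [Real.circleAverage, hre]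
  rw [← intervalIntegral.integral_add_adjacent_intervals (hint 0 π) (hint π (2 * π)), hreflect,
    smul_eq_mul]
  field_simp
  ring

theorem exists_circleAverage_exp_neg_mul_sq_le {q : ℝ} (hq : |q| ≠ 1) :
    ∃ C, ∀ K > 0, Real.circleAverage (fun z => Real.exp (-K * (z.re + q) ^ 2)) 0 1 ≤ C / √K := by
  obtain ⟨c, hc, t, hle⟩ := exists_mul_sq_le_sq_cos_add hq
  refine ⟨π⁻¹ * √(π / c), fun K hK => ?_⟩
  rw [circleAverage_comp_re (F := fun x => Real.exp (-K * (x + q) ^ 2)) (by fun_prop),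
    mul_div_assoc]
  have hgauss : Integrable fun u : ℝ => Real.exp (-(K * c) * (u - t) ^ 2) :=
    (integrable_exp_neg_mul_sq (mul_pos hK hc)).comp_sub_right t
  gcongr
  calc ∫ u in (0)..π, Real.exp (-K * (Real.cos u + q) ^ 2)
      ≤ ∫ u in (0)..π, Real.exp (-(K * c) * (u - t) ^ 2) := by
        refine intervalIntegral.integral_mono_on Real.pi_pos.le
          (Continuous.intervalIntegrable (by fun_prop) _ _) hgauss.intervalIntegrable
          fun u hu => Real.exp_le_exp.2 ?_
        nlinarith [hle u hu]
    _ ≤ ∫ u, Real.exp (-(K * c) * (u - t) ^ 2) := by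
        rw [intervalIntegral.integral_of_le Real.pi_pos.le]
        exact setIntegral_le_integral hgauss (ae_of_all _ fun u => (Real.exp_pos _).le)
    _ = √(π / c) / √K := by
        rw [integral_sub_right_eq_self fun u => Real.exp (-(K * c) * u ^ 2), integral_gaussian,
          ← Real.sqrt_div' _ hK.le, div_div, mul_comm c]

end GaussianOnCircle

section NormEstimate

variable {a b L : ℝ}

theorem differentiable_quadraticExp (a b L : ℝ) : Differentiable ℂ (quadraticExp a b L) := by
  unfold quadraticExp
  fun_prop

theorem deriv_quadraticExp (a b L : ℝ) (z : ℂ) :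
    deriv (quadraticExp a b L) z = -L * (a + 2 * b * z) * quadraticExp a b L z := by
  have h : HasDerivAt (fun z : ℂ => -(L : ℂ) * (a * z + b * z ^ 2)) (-L * (a + 2 * b * z)) z := by
    refine ((((hasDerivAt_id' z).const_mul (a : ℂ)).add
      ((hasDerivAt_pow 2 z).const_mul (b : ℂ))).const_mul (-(L : ℂ))).congr_deriv ?_
    push_cast
    ring
  rw [mul_comm]
  exact h.cexp.deriv

theorem norm_mul_deriv_quadraticExp_sub (a : ℝ) (hb : 0 < b) (hL : 0 ≤ L) {z : ℂ}
    (hz : ‖z‖ = 1) :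
    ‖z * deriv (quadraticExp a b L) z - (2 * b * L : ℝ) * quadraticExp a b L z‖ =
      4 * b * L * |z.re + a / (4 * b)| * ‖quadraticExp a b L z‖ := by
  have hconj : z * conj z = 1 := by rw [Complex.mul_conj', hz]; norm_num
  have hfactor : z * deriv (quadraticExp a b L) z - (2 * b * L : ℝ) * quadraticExp a b L z =
      -z * (4 * b * L * (z.re + a / (4 * b)) : ℝ) * quadraticExp a b L z := by
    have hb' : (b : ℂ) ≠ 0 := Complex.ofReal_ne_zero.2 hb.ne'
    rw [deriv_quadraticExp]
    push_cast
    rw [Complex.re_eq_add_conj]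
    field_simp
    linear_combination 4 * b * L * quadraticExp a b L z * hconj
  rw [hfactor, norm_mul, norm_mul, norm_neg, hz, one_mul, Complex.norm_real, Real.norm_eq_abs,
    abs_mul, abs_of_nonneg (by positivity)]

theorem sq_norm_quadraticExp_add_le (a : ℝ) (hb : 0 < b) (hL : 0 < L) {z : ℂ} (hz : ‖z‖ = 1) :
    ‖quadraticExp a b L z‖ ^ 2 + (√L)⁻¹ ^ 2 *
        ‖z * deriv (quadraticExp a b L) z - (2 * b * L : ℝ) * quadraticExp a b L z‖ ^ 2 ≤
      (1 + 8 * b) * Real.exp (L * (a ^ 2 / (8 * b) + b)) ^ 2 *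
        Real.exp (-(2 * b * L) * (z.re + a / (4 * b)) ^ 2) := by
  set y := z.re + a / (4 * b) with hy
  set M := a ^ 2 / (8 * b) + b
  have hnorm : ‖quadraticExp a b L z‖ = Real.exp (L * M) * Real.exp (-(2 * b * L) * y ^ 2) := by
    rw [norm_quadraticExp a hb.ne', hz, ← Real.exp_add]
    congr 1
    ring
  have hexp : (1 + 8 * b * (2 * b * L * y ^ 2)) * Real.exp (-(2 * b * L) * y ^ 2) ≤ 1 + 8 * b := by
    have hv : 0 ≤ 2 * b * L * y ^ 2 := by positivity
    rw [neg_mul, Real.exp_neg, ← div_eq_mul_inv, div_le_iff₀ (Real.exp_pos _)]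
    nlinarith [Real.add_one_le_exp (2 * b * L * y ^ 2)]
  calc _ = (1 + 8 * b * (2 * b * L * y ^ 2)) * ‖quadraticExp a b L z‖ ^ 2 := by
        rw [norm_mul_deriv_quadraticExp_sub a hb hL.le hz, inv_pow, Real.sq_sqrt hL.le, ← hy,
          mul_pow, mul_pow, sq_abs]
        field_simp
        ring
    _ = Real.exp (L * M) ^ 2 * (((1 + 8 * b * (2 * b * L * y ^ 2)) *
          Real.exp (-(2 * b * L) * y ^ 2)) * Real.exp (-(2 * b * L) * y ^ 2)) := by
        rw [hnorm]
        ring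
    _ ≤ Real.exp (L * M) ^ 2 * ((1 + 8 * b) * Real.exp (-(2 * b * L) * y ^ 2)) := by gcongr
    _ = _ := by ring

theorem exists_taylorNorm_quadraticExp_le (hb : 0 < b) (hab : |a| ≠ 4 * b) :
    ∃ C, ∀ L ≥ 1,
      taylorNorm (quadraticExp a b L) ≤ C * Real.exp (L * (a ^ 2 / (8 * b) + b)) := by
  obtain ⟨C, hC⟩ := exists_circleAverage_exp_neg_mul_sq_le (q := a / (4 * b)) <| by
    rwa [abs_div, abs_of_pos (by positivity : 0 < 4 * b), ne_eq, div_eq_one_iff_eq (by positivity)]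
  refine ⟨√(4 * π * (1 + 8 * b) * (C / √(2 * b))), fun L hL => ?_⟩
  have hL₀ : 0 < L := one_pos.trans_le hL
  have hG := differentiable_quadraticExp a b L
  have hcont := hG.continuous
  have hcont' := hG.deriv.continuous
  set E := Real.exp (L * (a ^ 2 / (8 * b) + b))
  have hprefactor : 2 * π * (1 + (√L)⁻¹ ^ 2) / (√L)⁻¹ ≤ 4 * π * √L := by
    have := inv_le_one_of_one_le₀ hL
    rw [inv_pow, Real.sq_sqrt hL₀.le, div_inv_eq_mul]
    calc 2 * π * (1 + L⁻¹) * √L ≤ 2 * π * (1 + 1) * √L := by gcongr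
      _ = 4 * π * √L := by ring
  have havg : Real.circleAverage (fun z => ‖quadraticExp a b L z‖ ^ 2 + (√L)⁻¹ ^ 2 *
      ‖z * deriv (quadraticExp a b L) z - (2 * b * L : ℝ) * quadraticExp a b L z‖ ^ 2) 0 1 ≤
      (1 + 8 * b) * E ^ 2 * (C / √(2 * b * L)) := by
    refine (Real.circleAverage_mono (Continuous.continuousOn (by fun_prop)).circleIntegrable'
      (Continuous.continuousOn (by fun_prop)).circleIntegrable' fun z hz =>
      sq_norm_quadraticExp_add_le a hb hL₀ (by simpa using hz)).trans ?_
    simp only [← smul_eq_mul ((1 + 8 * b) * E ^ 2), E, Real.circleAverage_fun_smul]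
    exact mul_le_mul_of_nonneg_left (hC _ (by positivity)) (by positivity)
  have hsq : taylorNorm (quadraticExp a b L) ^ 2 ≤
      4 * π * (1 + 8 * b) * (C / √(2 * b)) * E ^ 2 :=
    calc _ ≤ _ := taylorNorm_sq_le hG (by positivity : 0 < (√L)⁻¹) (2 * b * L)
      _ ≤ 4 * π * √L * ((1 + 8 * b) * E ^ 2 * (C / √(2 * b * L))) := by
          refine mul_le_mul hprefactor havg ?_ (by positivity)
          exact Real.circleAverage_nonneg_of_nonneg fun z _ => by positivity
      _ = _ := by
          rw [Real.sqrt_mul (by positivity) L]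
          field_simp
  refine (Real.le_sqrt_of_sq_le hsq).trans_eq ?_
  rw [Real.sqrt_mul' _ (sq_nonneg E), Real.sqrt_sq (Real.exp_pos _).le]

end NormEstimate

section Sufficiency

variable {r c₀ : ℕ} {c₁ : ℂ} {a b : ℝ}

theorem exists_eval_eq_natCast_cpow_neg_quadraticSymbol (hr : r ≠ 0) (c₀ : ℕ) (c₁ : ℂ)
    (a b : ℝ) : ∃ v : ℕ+ → WienerDirichlet,
      (∀ n s, 0 < s.re → (v n).eval s = ((n : ℕ) : ℂ) ^ (-quadraticSymbol r c₀ c₁ a b s)) ∧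
      ∀ n : ℕ+, ‖v n‖ ≤
        Real.exp (-(Real.log n * c₁.re)) * taylorNorm (quadraticExp a b (Real.log n)) := by
  suffices h : ∀ n : ℕ+, ∃ f : WienerDirichlet,
      (∀ s, 0 < s.re → f.eval s = ((n : ℕ) : ℂ) ^ (-quadraticSymbol r c₀ c₁ a b s)) ∧
      ‖f‖ ≤ Real.exp (-(Real.log n * c₁.re)) *
        taylorNorm (quadraticExp a b (Real.log n)) by
    choose v hv hnorm using h
    exact ⟨v, hv, hnorm⟩
  intro n
  lift r to ℕ+ using Nat.pos_of_ne_zero hr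
  set G := quadraticExp a b (Real.log n)
  have hG : Differentiable ℂ G := differentiable_quadraticExp a b _
  obtain ⟨f, hf, heval⟩ := exists_eval_eq_mul_powerSeries (summable_norm_taylorCoeff hG)
    (n ^ c₀) r
  refine ⟨((n : ℕ) : ℂ) ^ (-c₁) • f, fun s hs => ?_, ?_⟩
  · rw [natCast_cpow_neg_quadraticSymbol, mul_assoc, ← evalCLM_apply s hs.le, map_smul,
      evalCLM_apply, smul_eq_mul,
      (heval s hs.le).unique ((hasSum_taylorCoeff hG _).mul_left _)]
  · rw [norm_smul, norm_natCast_cpow_neg]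
    gcongr
    exact hf

theorem boundedComposition_quadraticSymbol (hr : r ≠ 0) (hb : 0 < b) (hab : |a| ≠ 4 * b)
    (hc : a ^ 2 / (8 * b) + b ≤ c₁.re) : BoundedComposition (quadraticSymbol r c₀ c₁ a b) := by
  obtain ⟨v, hv, hnorm⟩ := exists_eval_eq_natCast_cpow_neg_quadraticSymbol hr c₀ c₁ a b
  obtain ⟨C, hC⟩ := exists_taylorNorm_quadraticExp_le hb hab
  refine boundedComposition_of_isBoundedUnder_cofinite hv
    ⟨|C|, eventually_map.2 ?_⟩
  filter_upwards [tendsto_log_cofinite.eventually_ge_atTop 1] with n hn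
  have hlog : 0 ≤ Real.log n := zero_le_one.trans hn
  calc ‖v n‖ ≤ Real.exp (-(Real.log n * c₁.re)) *
        (|C| * Real.exp (Real.log n * (a ^ 2 / (8 * b) + b))) := by
        refine (hnorm n).trans ?_
        gcongr
        exact (hC _ hn).trans (by gcongr; exact le_abs_self C)
    _ = |C| * Real.exp (-(Real.log n * (c₁.re - (a ^ 2 / (8 * b) + b)))) := by
        rw [mul_left_comm, ← Real.exp_add]
        ring_nf
    _ ≤ |C| := by
        refine mul_le_of_le_one_right (abs_nonneg C) (Real.exp_le_one_iff.2 ?_)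
        exact neg_nonpos.2 (mul_nonneg hlog (sub_nonneg.2 hc))

theorem taylorNorm_quadraticExp_le (a : ℝ) (hb : 0 < b) {L ρ : ℝ} (hL : 0 ≤ L) (hρ : 1 < ρ) :
    taylorNorm (quadraticExp a b L) ≤
      Real.exp (L * (a ^ 2 / (8 * b) + b * ρ ^ 2)) * (1 - ρ⁻¹)⁻¹ := by
  refine taylorNorm_le_of_forall_mem_sphere (differentiable_quadraticExp a b L) hρ fun z hz => ?_
  rw [norm_quadraticExp a hb.ne', mem_sphere_zero_iff_norm.1 hz]
  exact Real.exp_le_exp.2 (sub_le_self _ (by positivity))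

theorem compactComposition_quadraticSymbol (hr : r ≠ 0) (hb : 0 < b)
    (hc : a ^ 2 / (8 * b) + b < c₁.re) : CompactComposition (quadraticSymbol r c₀ c₁ a b) := by
  obtain ⟨v, hv, hnorm⟩ := exists_eval_eq_natCast_cpow_neg_quadraticSymbol hr c₀ c₁ a b
  obtain ⟨ρ, hρ, hgap⟩ : ∃ ρ > 1, a ^ 2 / (8 * b) + b * ρ ^ 2 < c₁.re := by
    have hcont : Continuous fun ρ : ℝ => a ^ 2 / (8 * b) + b * ρ ^ 2 := by fun_prop
    have hnear : ∀ᶠ ρ in 𝓝[>] 1, a ^ 2 / (8 * b) + b * ρ ^ 2 < c₁.re :=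
      nhdsWithin_le_nhds (hcont.continuousAt.eventually_lt_const (by simpa using hc))
    exact (eventually_mem_nhdsWithin.and hnear).exists
  refine compactComposition_of_tendsto_cofinite hv
    (squeeze_zero (fun _ => norm_nonneg _) (fun n => ?_) ?_ (g := fun n : ℕ+ => Real.exp
      (-((c₁.re - (a ^ 2 / (8 * b) + b * ρ ^ 2)) * Real.log n)) * (1 - ρ⁻¹)⁻¹))
  · calc ‖v n‖ ≤ Real.exp (-(Real.log n * c₁.re)) *
          (Real.exp (Real.log n * (a ^ 2 / (8 * b) + b * ρ ^ 2)) * (1 - ρ⁻¹)⁻¹) :=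
          (hnorm n).trans (by gcongr; exact taylorNorm_quadraticExp_le a hb (by positivity) hρ)
      _ = _ := by
          rw [← mul_assoc, ← Real.exp_add]
          ring_nf
  · simpa using (Real.tendsto_exp_neg_atTop_nhds_zero.comp
      (tendsto_log_cofinite.const_mul_atTop (sub_pos.2 hgap))).mul_const (1 - ρ⁻¹)⁻¹

end Sufficiency

section Chirp

theorem sum_pow_mul_conj_pow {N : ℕ} {ζ : ℂ} (hζ : IsPrimitiveRoot ζ N) {u v : ℕ} (hu : u < N)
    (hv : v < N) :
    ∑ k ∈ Finset.range N, ζ ^ (u * k) * conj (ζ ^ (v * k)) = if u = v then (N : ℂ) else 0 := by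
  have hN : N ≠ 0 := by lia
  have hζ₀ : ζ ≠ 0 := hζ.ne_zero hN
  have hterm (k : ℕ) : ζ ^ (u * k) * conj (ζ ^ (v * k)) = (ζ ^ u / ζ ^ v) ^ k := by
    rw [map_pow, ← Complex.inv_eq_conj (hζ.norm'_eq_one hN), inv_pow, ← div_eq_mul_inv, pow_mul,
      pow_mul, div_pow]
  simp only [hterm]
  split_ifs with huv
  · simp [huv, hζ₀]
  · have hne : ζ ^ u / ζ ^ v ≠ 1 := fun h =>
      huv (hζ.pow_inj hu hv (eq_of_div_eq_one h))
    rw [geom_sum_eq hne, div_pow, pow_right_comm, pow_right_comm ζ v, hζ.pow_eq_one]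
    simp

theorem sum_sq_norm_sum_mul_pow {N : ℕ} {ζ : ℂ} (hζ : IsPrimitiveRoot ζ N) (x : ℕ → ℂ) :
    ∑ k ∈ Finset.range N, ‖∑ u ∈ Finset.range N, x u * ζ ^ (u * k)‖ ^ 2 =
      N * ∑ u ∈ Finset.range N, ‖x u‖ ^ 2 := by
  apply Complex.ofReal_injective
  push_cast
  calc ∑ k ∈ Finset.range N, (‖∑ u ∈ Finset.range N, x u * ζ ^ (u * k)‖ : ℂ) ^ 2
      = ∑ k ∈ Finset.range N, ∑ u ∈ Finset.range N, ∑ v ∈ Finset.range N,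
          x u * conj (x v) * (ζ ^ (u * k) * conj (ζ ^ (v * k))) := by
        refine Finset.sum_congr rfl fun k _ => ?_
        rw [← Complex.mul_conj', map_sum, Finset.sum_mul_sum]
        simp only [map_mul, mul_mul_mul_comm]
    _ = ∑ u ∈ Finset.range N, ∑ v ∈ Finset.range N, x u * conj (x v) *
          ∑ k ∈ Finset.range N, ζ ^ (u * k) * conj (ζ ^ (v * k)) := by
        rw [Finset.sum_comm]
        refine Finset.sum_congr rfl fun u _ => ?_
        rw [Finset.sum_comm]
        simp only [Finset.mul_sum]
    _ = ∑ u ∈ Finset.range N, ∑ v ∈ Finset.range N,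
          if u = v then x u * conj (x v) * N else 0 := by
        refine Finset.sum_congr rfl fun u hu => Finset.sum_congr rfl fun v hv => ?_
        rw [sum_pow_mul_conj_pow hζ (Finset.mem_range.1 hu) (Finset.mem_range.1 hv), mul_ite,
          mul_zero]
    _ = _ := by
        rw [Finset.mul_sum]
        refine Finset.sum_congr rfl fun u hu => ?_
        rw [Finset.sum_ite_eq, if_pos hu, Complex.mul_conj', mul_comm]

theorem norm_sum_mul_mul_pow_le {N : ℕ} {ζ : ℂ} (hζ : IsPrimitiveRoot ζ N) (x y : ℕ → ℂ) :
    ‖∑ p ∈ Finset.range N ×ˢ Finset.range N, x p.1 * y p.2 * ζ ^ (p.1 * p.2)‖ ≤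
      √(N * (∑ u ∈ Finset.range N, ‖x u‖ ^ 2) * ∑ v ∈ Finset.range N, ‖y v‖ ^ 2) := by
  have hiterate : ∑ p ∈ Finset.range N ×ˢ Finset.range N, x p.1 * y p.2 * ζ ^ (p.1 * p.2) =
      ∑ v ∈ Finset.range N, (∑ u ∈ Finset.range N, x u * ζ ^ (u * v)) * y v := by
    rw [Finset.sum_product_right]
    simp only [Finset.sum_mul, mul_right_comm]
  refine Real.le_sqrt_of_sq_le ?_
  rw [hiterate, ← sum_sq_norm_sum_mul_pow hζ]
  calc _ ≤ (∑ v ∈ Finset.range N, ‖∑ u ∈ Finset.range N, x u * ζ ^ (u * v)‖ * ‖y v‖) ^ 2 := by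
        gcongr
        exact (norm_sum_le _ _).trans_eq (by simp only [norm_mul])
    _ ≤ _ := Finset.sum_mul_sq_le_sq_mul_sq _ _ _

/-- The quadratic phase `exp (-π i j ^ 2 / N)`. -/
noncomputable def chirp (N j : ℕ) : ℂ := Complex.exp ((-(π * j ^ 2 / N) : ℝ) * Complex.I)

theorem norm_chirp (N j : ℕ) : ‖chirp N j‖ = 1 := Complex.norm_exp_ofReal_mul_I _

theorem chirp_add (N u v : ℕ) : chirp N (u + v) =
    chirp N u * chirp N v * (Complex.exp (2 * π * Complex.I / N))⁻¹ ^ (u * v) := by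
  simp only [chirp, ← Complex.exp_neg, ← Complex.exp_nat_mul, ← Complex.exp_add]
  congr 1
  push_cast
  ring

theorem norm_sum_chirp_mul_pow_le {N : ℕ} (hN : N ≠ 0) {w : ℂ} (hw : ‖w‖ = 1) :
    ‖∑ p ∈ Finset.range N ×ˢ Finset.range N, chirp N (p.1 + p.2) * w ^ (p.1 + p.2)‖ ≤
      √((N : ℝ) ^ 3) := by
  have hnorm (u : ℕ) : ‖chirp N u * w ^ u‖ = 1 := by
    rw [norm_mul, norm_pow, hw, one_pow, norm_chirp, one_mul]
  have h := norm_sum_mul_mul_pow_le (Complex.isPrimitiveRoot_exp N hN).inv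
    (fun u => chirp N u * w ^ u) fun v => chirp N v * w ^ v
  simp only [hnorm, one_pow, Finset.sum_const, Finset.card_range, nsmul_one] at h
  convert h using 3
  · rw [chirp_add, pow_add]
    ring
  · ring

theorem natCast_cpow_neg_add_mul (n : ℕ+) (s d : ℂ) (j : ℕ) :
    ((n : ℕ) : ℂ) ^ (-(s + j * d)) = ((n : ℕ) : ℂ) ^ (-s) * (((n : ℕ) : ℂ) ^ (-d)) ^ j := by
  rw [neg_add, Complex.cpow_add _ _ (Nat.cast_ne_zero.2 n.ne_zero), ← mul_neg,
    Complex.cpow_nat_mul]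

theorem norm_sum_chirp_mul_eval_le {N : ℕ} (hN : N ≠ 0) {w s d : ℂ} (hw : ‖w‖ = 1)
    (hs : 0 ≤ s.re) (hd : d.re = 0) (f : WienerDirichlet) :
    ‖∑ p ∈ Finset.range N ×ˢ Finset.range N, chirp N (p.1 + p.2) * w ^ (p.1 + p.2) *
      f.eval (s + (p.1 + p.2 : ℕ) * d)‖ ≤ ‖f‖ * √((N : ℝ) ^ 3) := by
  refine norm_sum_eval_le (fun p => ?_) (fun n => ?_) f
  · rw [Complex.add_re, ← Complex.ofReal_natCast, Complex.re_ofReal_mul, hd, mul_zero, add_zero]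
    exact hs
  · have hwd : ‖w * ((n : ℕ) : ℂ) ^ (-d)‖ = 1 := by
      rw [norm_mul, hw, norm_natCast_cpow_neg, hd, mul_zero, neg_zero, Real.exp_zero, one_mul]
    calc _ = ‖((n : ℕ) : ℂ) ^ (-s)‖ * ‖∑ p ∈ Finset.range N ×ˢ Finset.range N,
          chirp N (p.1 + p.2) * (w * ((n : ℕ) : ℂ) ^ (-d)) ^ (p.1 + p.2)‖ := by
          rw [← norm_mul, Finset.mul_sum]
          congr 1
          refine Finset.sum_congr rfl fun p _ => ?_
          rw [natCast_cpow_neg_add_mul, mul_pow]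
          ring
      _ ≤ 1 * √((N : ℝ) ^ 3) := by
          gcongr
          · exact norm_natCast_cpow_neg_le_one hs n
          · exact norm_sum_chirp_mul_pow_le hN hwd
      _ = _ := one_mul _

end Chirp

section FlatPhase

/-- The curve `4 exp (i t) - exp (2 i t) - 3`. Its second derivative at `t = 0` vanishes, so that
near `0` it is a purely imaginary cubic up to an error of order four. -/
noncomputable def flatPhase (t : ℝ) : ℂ :=
  4 * Complex.exp (t * Complex.I) - Complex.exp (t * Complex.I) ^ 2 - 3

theorem norm_exp_mul_I_sub_cubic_le {x : ℝ} (hx : |x| ≤ 5 / 2) :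
    ‖Complex.exp (x * Complex.I) -
      (1 - x ^ 2 / 2 + (x - x ^ 3 / 6) * Complex.I)‖ ≤ x ^ 4 / 12 := by
  have hnorm : ‖(x : ℂ) * Complex.I‖ = |x| := by simp
  have h := Complex.exp_bound' (x := x * Complex.I) (n := 4) <| by
    rw [hnorm]
    norm_num
    linarith
  have hsum : ∑ m ∈ Finset.range 4, ((x : ℂ) * Complex.I) ^ m / m.factorial =
      1 - x ^ 2 / 2 + (x - x ^ 3 / 6) * Complex.I := by
    simp only [Finset.sum_range_succ, Finset.sum_range_zero, Nat.factorial, mul_pow,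
      Complex.I_sq, Complex.I_pow_three]
    push_cast
    ring
  rw [hsum, hnorm, Even.pow_abs (by decide)] at h
  exact h.trans_eq (by norm_num [Nat.factorial]; ring)

theorem norm_flatPhase_sub_le {t : ℝ} (ht : |t| ≤ 1) :
    ‖flatPhase t - (2 * t + 2 / 3 * t ^ 3 : ℝ) * Complex.I‖ ≤ 5 / 3 * t ^ 4 := by
  have h₁ := norm_exp_mul_I_sub_cubic_le (x := t) (by linarith)
  have h₂ := norm_exp_mul_I_sub_cubic_le (x := 2 * t) (by rw [abs_mul, abs_two]; linarith)
  have hexp : Complex.exp (t * Complex.I) ^ 2 = Complex.exp ((2 * t : ℝ) * Complex.I) := by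
    rw [← Complex.exp_nat_mul]
    push_cast
    ring_nf
  calc _ = ‖4 * (Complex.exp (t * Complex.I) - (1 - t ^ 2 / 2 + (t - t ^ 3 / 6) * Complex.I)) -
        (Complex.exp ((2 * t : ℝ) * Complex.I) - (1 - (2 * t : ℝ) ^ 2 / 2 +
          ((2 * t : ℝ) - (2 * t : ℝ) ^ 3 / 6) * Complex.I))‖ := by
        rw [flatPhase, hexp]
        push_cast
        ring_nf
    _ ≤ 4 * (t ^ 4 / 12) + (2 * t) ^ 4 / 12 := by
        refine (norm_sub_le _ _).trans (add_le_add ?_ h₂)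
        rw [norm_mul, Complex.norm_ofNat]
        gcongr
    _ = 5 / 3 * t ^ 4 := by ring

theorem tendsto_inv_pow_mul_flatPhase (κ x : ℝ) :
    Tendsto (fun η : ℝ => (η⁻¹ ^ 11 : ℝ) * flatPhase (η ^ 3 + x * (κ * η ^ 4)) -
      (2 * η⁻¹ ^ 8 + 2 / 3 * η⁻¹ ^ 2 + κ * (2 * η⁻¹ ^ 7 + 2 * η⁻¹) * x + 2 * κ ^ 2 * x ^ 2 : ℝ) *
        Complex.I) (𝓝[>] 0) (𝓝 0) := by
  have hlim (g : ℝ → ℝ) (hg : Continuous g) (h₀ : g 0 = 0) : Tendsto g (𝓝[>] 0) (𝓝 0) :=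
    (hg.tendsto' 0 0 h₀).mono_left nhdsWithin_le_nhds
  refine squeeze_zero_norm' ?_ (hlim
    (fun η => 5 / 3 * η * (1 + x * κ * η) ^ 4 + |2 / 3 * (κ * x) ^ 3 * η|) (by fun_prop) (by simp))
  filter_upwards [(hlim (fun η => |η ^ 3 + x * (κ * η ^ 4)|) (by fun_prop)
    (by simp)).eventually_le_const one_pos, self_mem_nhdsWithin] with η hsmall (hη : 0 < η)
  set t := η ^ 3 + x * (κ * η ^ 4) with ht
  have hcubic : η⁻¹ ^ 11 * (2 * t + 2 / 3 * t ^ 3) =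
      2 * η⁻¹ ^ 8 + 2 / 3 * η⁻¹ ^ 2 + κ * (2 * η⁻¹ ^ 7 + 2 * η⁻¹) * x + 2 * κ ^ 2 * x ^ 2 +
        2 / 3 * (κ * x) ^ 3 * η := by
    rw [ht]
    field_simp
    ring
  calc _ = ‖(η⁻¹ ^ 11 : ℝ) * (flatPhase t - (2 * t + 2 / 3 * t ^ 3 : ℝ) * Complex.I) +
        (2 / 3 * (κ * x) ^ 3 * η : ℝ) * Complex.I‖ := by
        rw [mul_sub, ← mul_assoc, ← Complex.ofReal_mul, hcubic, Complex.ofReal_add _ (_ * η)]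
        ring_nf
    _ ≤ η⁻¹ ^ 11 * (5 / 3 * t ^ 4) + |2 / 3 * (κ * x) ^ 3 * η| := by
        refine norm_add_le_of_le ?_ (by rw [norm_mul, Complex.norm_I, mul_one, Complex.norm_real,
          Real.norm_eq_abs])
        rw [norm_mul, Complex.norm_real, Real.norm_of_nonneg (by positivity)]
        gcongr
        exact norm_flatPhase_sub_le hsmall
    _ = _ := by
        rw [ht]
        field_simp

/-- The scale is chosen so that, at the step `h K`, the curve `K * flatPhase` still sees the
quadratic term `γ j ^ 2` coming from the cubic, while the quartic error is already negligible. -/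
theorem exists_tendsto_mul_flatPhase {γ : ℝ} (hγ : 0 ≤ γ) : ∃ t h A D : ℝ → ℝ, ∀ j : ℕ,
    Tendsto (fun K : ℝ => K * flatPhase (t K + j * h K) -
      (A K + D K * j + γ * j ^ 2 : ℝ) * Complex.I) atTop (𝓝 0) := by
  set κ := √(γ / 2)
  have hκ : 2 * κ ^ 2 = γ := by rw [Real.sq_sqrt (by positivity), mul_div_cancel₀ _ two_ne_zero]
  let η (K : ℝ) : ℝ := K ^ (-11⁻¹ : ℝ)
  have hη : Tendsto η atTop (𝓝[>] 0) := by
    refine tendsto_nhdsWithin_iff.2 ⟨tendsto_rpow_neg_atTop (by norm_num), ?_⟩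
    filter_upwards [eventually_gt_atTop 0] with K hK using Real.rpow_pos_of_pos hK _
  refine ⟨fun K => η K ^ 3, fun K => κ * η K ^ 4, fun K => 2 * (η K)⁻¹ ^ 8 + 2 / 3 * (η K)⁻¹ ^ 2,
    fun K => κ * (2 * (η K)⁻¹ ^ 7 + 2 * (η K)⁻¹), fun j => ?_⟩
  refine ((tendsto_inv_pow_mul_flatPhase κ j).comp hη).congr' ?_
  filter_upwards [eventually_ge_atTop 0] with K hK
  have hK' : (η K)⁻¹ ^ 11 = K := by
    rw [← Real.rpow_neg hK, neg_neg]
    exact Real.rpow_inv_natCast_pow hK (by norm_num : 11 ≠ 0)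
  simp only [Function.comp_apply, hK', hκ]

end FlatPhase

section CriticalCase

variable {r c₀ : ℕ} {c₁ : ℂ} {a b : ℝ}

theorem exists_quadraticExp_eq_exp_flatPhase (hb : 0 < b) (hab : |a| = 4 * b) : ∃ τ : ℝ, ∀ L t : ℝ,
    quadraticExp a b L (Complex.exp ((τ + t : ℝ) * Complex.I)) =
      Complex.exp (L * (3 * b : ℝ)) * Complex.exp ((b * L : ℝ) * flatPhase t) := by
  obtain ⟨τ, σ, hσ, ha, hτ⟩ : ∃ (τ : ℝ) (σ : ℂ), σ ^ 2 = 1 ∧ (a : ℂ) = -(4 * b * σ) ∧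
      Complex.exp (τ * Complex.I) = σ := by
    obtain rfl | rfl := (abs_eq (by positivity)).1 hab
    · exact ⟨π, -1, by norm_num, by push_cast; ring, Complex.exp_pi_mul_I⟩
    · exact ⟨0, 1, one_pow 2, by push_cast; ring, by simp⟩
  refine ⟨τ, fun L t => ?_⟩
  rw [quadraticExp, flatPhase, ← Complex.exp_add, Complex.ofReal_add, add_mul, Complex.exp_add, hτ,
    ha]
  congr 1
  push_cast
  linear_combination (L * b * (4 * Complex.exp (t * Complex.I) -
    Complex.exp (t * Complex.I) ^ 2)) * hσ

theorem exists_natCast_cpow_neg_quadraticSymbol_eq_exp_flatPhase (hr : 2 ≤ r) (c₀ : ℕ) (c₁ : ℂ)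
    (hb : 0 < b) (hab : |a| = 4 * b) : ∃ τ : ℝ, ∀ (n : ℕ+) (t : ℝ),
      ((n : ℕ) : ℂ) ^ (-quadraticSymbol r c₀ c₁ a b (boundaryPoint r (τ + t))) =
        ((n : ℕ) : ℂ) ^ (-(c₁ - (3 * b : ℝ))) *
          (((n ^ c₀ : ℕ+) : ℕ) : ℂ) ^ (-boundaryPoint r (τ + t)) *
          Complex.exp ((b * Real.log n : ℝ) * flatPhase t) := by
  obtain ⟨τ, hτ⟩ := exists_quadraticExp_eq_exp_flatPhase hb hab
  refine ⟨τ, fun n t => ?_⟩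
  have hn : ((n : ℕ) : ℂ) ≠ 0 := Nat.cast_ne_zero.2 n.ne_zero
  rw [natCast_cpow_neg_quadraticSymbol, natCast_cpow_neg_boundaryPoint hr, hτ, Complex.natCast_log,
    ← Complex.cpow_def_of_ne_zero hn, neg_sub, sub_eq_neg_add, Complex.cpow_add _ _ hn]
  ring

theorem chirp_mul_exp_eq (N j : ℕ) (A D : ℝ) (z : ℂ) :
    chirp N j * Complex.exp z = Complex.exp (A * Complex.I) * Complex.exp (D * Complex.I) ^ j *
      Complex.exp (z - (A + D * j + π / N * j ^ 2 : ℝ) * Complex.I) := by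
  simp only [chirp, ← Complex.exp_nat_mul, ← Complex.exp_add]
  congr 1
  push_cast
  ring

theorem IsCompositionOperator.exists_chirp_mul_eval_eq (hr : 2 ≤ r) (hb : 0 < b)
    (hab : |a| = 4 * b) (hc : c₁.re = 3 * b) {T : WienerDirichlet →L[ℂ] WienerDirichlet}
    (hT : IsCompositionOperator (quadraticSymbol r c₀ c₁ a b) T) :
    ∃ τ : ℝ, ∀ (n : ℕ+) (t h A D : ℝ), ∃ w U : ℂ, ‖w‖ = 1 ∧ ‖U‖ = 1 ∧ ∀ N j : ℕ,
      chirp N j * w ^ j * (T (monomial n)).eval (boundaryPoint r (τ + t) + j * boundaryPoint r h) =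
        U * Complex.exp ((b * Real.log n : ℝ) * flatPhase (t + j * h) -
          (A + D * j + π / N * j ^ 2 : ℝ) * Complex.I) := by
  obtain ⟨τ, hτ⟩ := exists_natCast_cpow_neg_quadraticSymbol_eq_exp_flatPhase hr c₀ c₁ hb hab
  refine ⟨τ, fun n t h A D => ?_⟩
  set s := boundaryPoint r (τ + t)
  set d := boundaryPoint r h
  set w := (((n ^ c₀ : ℕ+) : ℕ) : ℂ) ^ (-d) * Complex.exp (D * Complex.I)
  set V := ((n : ℕ) : ℂ) ^ (-(c₁ - (3 * b : ℝ))) * (((n ^ c₀ : ℕ+) : ℕ) : ℂ) ^ (-s)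
  have hs : s.re = 0 := boundaryPoint_re _ _
  have hd : d.re = 0 := boundaryPoint_re _ _
  have hw : ‖w‖ = 1 := by
    rw [norm_mul, norm_natCast_cpow_neg, hd, Complex.norm_exp_ofReal_mul_I]
    simp
  have hV : ‖V‖ = 1 := by
    rw [norm_mul, norm_natCast_cpow_neg, norm_natCast_cpow_neg, hs, Complex.sub_re,
      Complex.ofReal_re, hc]
    simp
  refine ⟨w⁻¹, V * Complex.exp (A * Complex.I), by rw [norm_inv, hw, inv_one],
    by rw [norm_mul, hV, Complex.norm_exp_ofReal_mul_I, one_mul], fun N j => ?_⟩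
  have hw₀ : w ^ j ≠ 0 := pow_ne_zero j (norm_ne_zero_iff.1 (hw.trans_ne one_ne_zero))
  have hpoint : s + j * d = boundaryPoint r (τ + (t + j * h)) := by
    rw [← add_assoc, boundaryPoint_add_mul]
  have hre : 0 ≤ (s + j * d).re := by rw [hpoint, boundaryPoint_re]
  rw [hT.eval_map_monomial (continuous_quadraticSymbol (by lia)) n hre, hpoint, hτ, ← hpoint,
    natCast_cpow_neg_add_mul, inv_pow]
  have hchirp := chirp_mul_exp_eq N j A D ((b * Real.log n : ℝ) * flatPhase (t + j * h))
  generalize Complex.exp (_ - _) = E at hchirp ⊢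
  field_simp
  simp only [V, w, mul_pow]
  linear_combination (((n : ℕ) : ℂ) ^ (-(c₁ - (3 * b : ℝ))) *
    (((n ^ c₀ : ℕ+) : ℕ) : ℂ) ^ (-s) * ((((n ^ c₀ : ℕ+) : ℕ) : ℂ) ^ (-d)) ^ j) * hchirp

theorem IsCompositionOperator.sq_le_norm_mul_sqrt (hr : 2 ≤ r) (hb : 0 < b) (hab : |a| = 4 * b)
    (hc : c₁.re = 3 * b) {T : WienerDirichlet →L[ℂ] WienerDirichlet}
    (hT : IsCompositionOperator (quadraticSymbol r c₀ c₁ a b) T) {N : ℕ} (hN : N ≠ 0) :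
    (N : ℝ) ^ 2 ≤ ‖T‖ * √((N : ℝ) ^ 3) := by
  obtain ⟨τ, hτ⟩ := hT.exists_chirp_mul_eval_eq hr hb hab hc
  obtain ⟨t, h, A, D, hE⟩ := exists_tendsto_mul_flatPhase (γ := π / N) (by positivity)
  have hlim := (tendsto_finsetSum (Finset.range N ×ˢ Finset.range N)
    fun p _ => (hE (p.1 + p.2)).cexp).norm
  have hcard : ‖∑ _ ∈ Finset.range N ×ˢ Finset.range N, Complex.exp 0‖ = (N : ℝ) ^ 2 := by
    simp [sq]
  rw [hcard] at hlim
  refine le_of_tendsto' (hlim.comp (tendsto_log_cofinite.const_mul_atTop hb)) fun n => ?_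
  set K := b * Real.log n
  obtain ⟨w, U, hw, hU, hsample⟩ := hτ n (t K) (h K) (A K) (D K)
  calc _ = ‖∑ p ∈ Finset.range N ×ˢ Finset.range N, chirp N (p.1 + p.2) * w ^ (p.1 + p.2) *
          (T (monomial n)).eval
            (boundaryPoint r (τ + t K) + (p.1 + p.2 : ℕ) * boundaryPoint r (h K))‖ := by
        simp only [hsample, ← Finset.mul_sum, norm_mul, hU, one_mul, Function.comp_apply, K]
    _ ≤ ‖T (monomial n)‖ * √((N : ℝ) ^ 3) :=
        norm_sum_chirp_mul_eval_le hN hw (boundaryPoint_re _ _).ge (boundaryPoint_re _ _) _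
    _ ≤ ‖T‖ * √((N : ℝ) ^ 3) := by
        gcongr
        exact T.unit_le_opNorm _ (norm_monomial n).le

theorem not_boundedComposition_of_abs_eq (hr : 2 ≤ r) (hb : 0 < b) (hab : |a| = 4 * b)
    (hc : c₁.re = 3 * b) : ¬ BoundedComposition (quadraticSymbol r c₀ c₁ a b) := by
  rintro ⟨T, hT⟩
  obtain ⟨N, hN⟩ := exists_nat_gt (‖T‖ ^ 2)
  have hN₀ : (0 : ℝ) < N := (sq_nonneg _).trans_lt hN
  have hle := hT.sq_le_norm_mul_sqrt hr hb hab hc (N := N)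
    (Nat.cast_pos.1 hN₀).ne'
  have hsq : (N : ℝ) ^ 3 * N ≤ (N : ℝ) ^ 3 * ‖T‖ ^ 2 :=
    calc (N : ℝ) ^ 3 * N = ((N : ℝ) ^ 2) ^ 2 := by ring
      _ ≤ (‖T‖ * √((N : ℝ) ^ 3)) ^ 2 := by gcongr
      _ = (N : ℝ) ^ 3 * ‖T‖ ^ 2 := by rw [mul_pow, Real.sq_sqrt (by positivity), mul_comm]
  exact hN.not_ge (le_of_mul_le_mul_left hsq (by positivity))

end CriticalCase

theorem proposition2p6_general (r c₀ : ℕ) (hr : 2 ≤ r) (c₁ : ℂ) (a b : ℝ) (hb : 0 < b) :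
    (a ^ 2 / (8 * b) + b < c₁.re →
      BoundedComposition (quadraticSymbol r c₀ c₁ a b) ∧
        CompactComposition (quadraticSymbol r c₀ c₁ a b)) ∧
    (|a| ≤ 4 * b →
      (BoundedComposition (quadraticSymbol r c₀ c₁ a b) → a ^ 2 / (8 * b) + b ≤ c₁.re) ∧
      (CompactComposition (quadraticSymbol r c₀ c₁ a b) → a ^ 2 / (8 * b) + b < c₁.re)) ∧
    (c₁.re = a ^ 2 / (8 * b) + b →
      (BoundedComposition (quadraticSymbol r c₀ c₁ a b) ↔ |a| ≠ 4 * b)) := by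
  have hr₀ : r ≠ 0 := by lia
  refine ⟨fun hc => ?_,
    fun hab => ⟨le_re_of_boundedComposition hr hb hab, lt_re_of_compactComposition hr hb hab⟩,
    fun hc => ⟨fun h hab => not_boundedComposition_of_abs_eq hr hb hab ?_ h,
      fun hab => boundedComposition_quadraticSymbol hr₀ hb hab hc.ge⟩⟩
  · have hcompact := compactComposition_quadraticSymbol (c₀ := c₀) hr₀ hb hc
    exact ⟨hcompact.boundedComposition, hcompact⟩
  · rw [hc, ← sq_abs, hab]
    field_simp
    norm_num

theorem proposition2p6 (r c₀ : ℕ) (hr : 2 ≤ r) (c₁ : ℂ) (a b : ℝ) (ha : 0 < a) (hb : 0 < b) :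
    (a ^ 2 / (8 * b) + b < c₁.re →
      BoundedComposition (quadraticSymbol r c₀ c₁ a b) ∧
        CompactComposition (quadraticSymbol r c₀ c₁ a b)) ∧
    (a ≤ 4 * b →
      (BoundedComposition (quadraticSymbol r c₀ c₁ a b) → a ^ 2 / (8 * b) + b ≤ c₁.re) ∧
      (CompactComposition (quadraticSymbol r c₀ c₁ a b) → a ^ 2 / (8 * b) + b < c₁.re)) ∧
    (c₁.re = a ^ 2 / (8 * b) + b →
      (BoundedComposition (quadraticSymbol r c₀ c₁ a b) ↔ a ≠ 4 * b)) := by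
  simpa only [abs_of_pos ha] using proposition2p6_general r c₀ hr c₁ a b hb
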